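/- Let $\mathcal W$ be a nonprincipal ultrafilter on a countably infinite set $S$. $\mathcal W$ is a P-point if every function on $S$ is finite-to-one or constant on some set in $\mathcal W$. $\mathcal W$ is $(n,t)$-weakly Ramsey if, whenever the set $[S]^n$ of $n$-element subsets of $S$ is partitioned into finitely many pieces, there is $H\in\mathcal W$ such that $[H]^n$ meets at most $t$ of the pieces. An $n$-type is a linear pre-order of the $2n$ formal symbols $x_1,\dots,x_n,y_1,\dots,y_n$ such that $y_1<\dots<y_n$, $x_i<y_i$ for each $i$, and any two distinct equivalent symbols are both $x$'s; $T(n)$ is the number of $n$-types. An ultrafilter $\mathcal W$ on $\omega^2$ is a non-P-point in standard position if the first projection $\pi_1:\omega^2\to\omega$ is neither finite-to-one nor constant on any set in $\mathcal W$. It has the three-functions property if every function on $\omega^2$ is, when restricted to some set in $\mathcal W$, either constant, or one-to-one, or $\pi_1$ followed by a one-to-one function. Let $\mathfrak N$ be the standard model of full arithmetic, i.e., $\omega$ with function and relation symbols for all finitary functions and relations on $\omega$. For an ultrafilter $\mathcal U$ on a set $X$ and a function $f$ with domain $X$, let $f(\mathcal U)=\{A:f^{-1}(A)\in\mathcal U\}$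 and let $f_*:f(\mathcal U)\text{-prod}\,\mathfrak N\to\mathcal U\text{-prod}\,\mathfrak N$ be the elementary embedding $[g]_{f(\mathcal U)}\mapsto[g\circ f]_{\mathcal U}$ between ultrapowers of $\mathfrak N$. The map $f$ is conservative on $\mathcal U$ if $\mathcal U\text{-prod}\,\mathfrak N$ is a conservative extension of the image of $f_*$, i.e., the intersection of this image with any parametrically definable subset of $\mathcal U\text{-prod}\,\mathfrak N$ is parametrically definable in the image. Then: (a) If $\mathcal W$ is a nonprincipal ultrafilter on a countably infinite set and is not a P-point, then for all $m,n\geq 2$, $\mathcal W$ is $(m,T(m))$-weakly Ramsey if and only if it is $(n,T(n))$-weakly Ramsey. (b) If $\mathcal W$ is a non-P-point in standard position, then for every $n\geq 2$, $\mathcal W$ is $(n,T(n))$-weakly Ramsey if and only if $\mathcal W$ has the three-functions property and $\pi_1$ is a conservative map on $\mathcal W$. -/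

import Mathlib

open scoped FirstOrder

namespace WeakRamsey

/-! ### Ultrafilters on countably infinite sets -/

/-- An ultrafilter is nonprincipal if it contains every cofinite set. -/
def Nonprincipal {S : Type*} (W : Ultrafilter S) : Prop :=
  (W : Filter S) ≤ Filter.cofinite

/-- `f` is finite-to-one on `A`. -/
def FiniteToOneOn {S Y : Type*} (f : S → Y) (A : Set S) : Prop :=
  ∀ y : Y, {x ∈ A | f x = y}.Finite

/-- `f` is constant on `A`. -/
def ConstantOn {S Y : Type*} (f : S → Y) (A : Set S) : Prop :=
  ∃ y : Y, ∀ x ∈ A, f x = y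

/-- `W` is a P-point: every function on the underlying set is finite-to-one or constant on
some set in `W`. -/
def IsPPoint {S : Type*} (W : Ultrafilter S) : Prop :=
  ∀ (Y : Type) (f : S → Y), ∃ A ∈ W, FiniteToOneOn f A ∨ ConstantOn f A

/-- `W` is `(n,t)`-weakly Ramsey: whenever the set of `n`-element subsets of `S` is partitioned
into `k` pieces (given as the fibres of `c`), there is `H ∈ W` such that the `n`-element subsets
of `H` meet at most `t` of the pieces. -/
def IsWeaklyRamsey {S : Type*} (W : Ultrafilter S) (n t : ℕ) : Prop :=
  ∀ (k : ℕ) (c : {s : Finset S // s.card = n} → Fin k),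
    ∃ H ∈ W, {i : Fin k | ∃ s, (s.1 : Set S) ⊆ H ∧ c s = i}.ncard ≤ t

/-! ### Types -/

/-- An `n`-type: a linear pre-order of the `2n` formal symbols `x₁, …, xₙ` (left summand) and
`y₁, …, yₙ` (right summand) such that `y₁ < ⋯ < yₙ`, each `xᵢ` strictly precedes `yᵢ`, and
distinct equivalent symbols are both `x`'s. -/
structure NType (n : ℕ) where
  le : Fin n ⊕ Fin n → Fin n ⊕ Fin n → Prop
  refl : ∀ a, le a a
  trans : ∀ a b c, le a b → le b c → le a c
  total : ∀ a b, le a b ∨ le b a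
  y_lt : ∀ i j : Fin n, i < j → le (Sum.inr i) (Sum.inr j) ∧ ¬ le (Sum.inr j) (Sum.inr i)
  x_lt_y : ∀ i : Fin n, le (Sum.inl i) (Sum.inr i) ∧ ¬ le (Sum.inr i) (Sum.inl i)
  eq_or_x : ∀ a b, le a b → le b a → a ≠ b →
    (∃ i, a = Sum.inl i) ∧ (∃ j, b = Sum.inl j)

instance (n : ℕ) : Finite (NType n) :=
  Finite.of_injective NType.le (by rintro ⟨⟩ ⟨⟩ h; cases h; rfl)

/-- `T n` is the number of `n`-types. -/
noncomputable def T (n : ℕ) : ℕ := Nat.card (NType n)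

/-! ### Standard position and the three functions property -/

/-- `W` is a non-P-point in standard position: the first projection is neither finite-to-one nor
constant on any set in `W`. -/
def IsStandardPosition (W : Ultrafilter (ℕ × ℕ)) : Prop :=
  ∀ A ∈ W, ¬ FiniteToOneOn (Prod.fst : ℕ × ℕ → ℕ) A ∧ ¬ ConstantOn (Prod.fst : ℕ × ℕ → ℕ) A

/-- The three functions property: every function on `ω²` is, on some set in `W`, constant,
one-to-one, or the first projection followed by a one-to-one function. -/
def ThreeFunctions (W : Ultrafilter (ℕ × ℕ)) : Prop :=
  ∀ (Y : Type) (f : ℕ × ℕ → Y), ∃ A ∈ W,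
    ConstantOn f A ∨ Set.InjOn f A ∨
      ∃ g : ℕ → Y, Set.InjOn g (Prod.fst '' A) ∧ ∀ p ∈ A, f p = g p.1

/-! ### Full arithmetic, its ultrapowers, and conservative maps -/

/-- The language of full arithmetic: a symbol for every finitary function and every finitary
relation on `ℕ`. -/
def fullArith : FirstOrder.Language.{0, 0} where
  Functions n := (Fin n → ℕ) → ℕ
  Relations n := (Fin n → ℕ) → Prop

/-- The standard model of full arithmetic. -/
instance fullArithNat : fullArith.Structure ℕ where
  funMap f x := f x
  RelMap R x := R x

/-- The ultrapower of the standard model by `U`, with the structure given by Mathlib's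
ultraproduct. -/
abbrev UPow {S : Type*} (U : Ultrafilter S) : Type _ :=
  (U : Filter S).Product (fun _ : S => ℕ)

/-- The class `[g]_U` of `g : S → ℕ` in the ultrapower by `U`. -/
def cls {S : Type*} (U : Ultrafilter S) (g : S → ℕ) : UPow U :=
  Quotient.mk _ g

/-- The map `[g]_{f(U)} ↦ [g ∘ f]_U`. -/
def pushFun {S R : Type*} (U : Ultrafilter S) (f : S → R) : UPow (U.map f) → UPow U :=
  Quotient.map' (fun g => g ∘ f) (fun _ _ h => h)

/-- The elementary embedding `f_*` of the ultrapower by `f(U)` into the ultrapower by `U`,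
`[g]_{f(U)} ↦ [g ∘ f]_U`. -/
def push {S R : Type*} (U : Ultrafilter S) (f : S → R) :
    UPow (U.map f) ↪ₑ[fullArith] UPow U where
  toFun := pushFun U f
  map_formula' := by
    intro n φ x
    obtain ⟨r, rfl⟩ : ∃ r : Fin n → R → ℕ, x = fun i => cls (U.map f) (r i) :=
      ⟨fun i => (x i).out, funext fun i => (Quotient.out_eq (x i)).symm⟩
    exact (FirstOrder.Language.Ultraproduct.realize_formula_cast (u := U) φ (fun i => r i ∘ f)).trans
      (FirstOrder.Language.Ultraproduct.realize_formula_cast (u := U.map f) φ r).symm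

/-- `B` is a conservative extension of `A`, where `A` is identified with an elementary submodel
of `B` along `j`: the trace on `A` of every parametrically definable subset of `B` is
parametrically definable in `A`. -/
def IsConservativeExtension {L : FirstOrder.Language} {A B : Type*} [L.Structure A] [L.Structure B]
    (j : A ↪ₑ[L] B) : Prop :=
  ∀ X : Set B, (Set.univ : Set B).Definable₁ L X → (Set.univ : Set A).Definable₁ L (j ⁻¹' X)

/-- `f` is a conservative map on `U`: the ultrapower by `U` is a conservative extension of the
ultrapower by `f(U)`, embedded by `f_*`. -/
def IsConservativeMap {S R : Type*} (U : Ultrafilter S) (f : S → R) : Prop :=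
  IsConservativeExtension (push U f)

end WeakRamsey

/-!
An ultrafilter `W` on a countable set that is not a P-point comes with a column function `x` that
is neither finite-to-one nor constant on any set in `W`. Together with an injection `y` that
exceeds `x` and takes different values, it assigns an `n`-type to every `n`-element set, and every
set in `W` realizes all `n`-types (`IsRich.exists_type_eq`). Hence `(n, T n)`-weak Ramseyness means
that every colouring of `n`-element sets is determined by the types on a set in `W`
(`IsHomogeneous`). For every `n ≥ 2` this turns out to be equivalent to the three-functions
property and conservativity of `x`, which do not involve `n` (`IsStandard.isWeaklyRamsey_iff`).

In one direction only pairs matter. For a function `f`, colour `{s, t}` according to whether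
`f s = f t`; homogeneity for the four `2`-types leaves three possibilities for `f`
(`hasThreeFunctions`). For a family of sets `X s ⊆ ℕ`, colour `{s, t}` by their lexicographic
order; on a homogeneous set they are monotone along each column and therefore converge to a set
attached to the column (`isConservative`).

In the other direction, the values of the symbols of a type are removed one by one, starting with
the largest (`exists_fits_homogeneous`). Removing a column is a limit along `x(W)`. Removing a point
in an earlier column `a` is a limit along column `a`, which carries no ultrafilter; conservativity
provides the limit all the same, and `IsConservative.exists_agree` says that it is attained up to
any function of the column. To attain all limits on one set in `W`, that set has to be so sparse
that its values of `x` and of `y` lie arbitrarily far apart (`exists_sparse`). This follows from the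
three-functions property, because a finite-to-one function is injective on all the values of `x`
and `y` on some set in `W` (`exists_injOn_values`).

Conservativity in the sense of model theory reduces to a statement about families of sets of
natural numbers because, by Łoś's theorem, the parametrically definable subsets of an ultrapower of
full arithmetic are exactly the internal ones (`definable₁_iff_internal`).
-/

namespace WeakRamsey

open Filter FirstOrder FirstOrder.Language

/-! ### Coordinates -/

/-- Two numerical coordinates on `S` from which the types of finite subsets of `S` are read off:
`x` names the column of a point, and `y` names the point itself. Values of `x` and of `y` are
never equal, so that every finite set of points has a type. -/
structure Coordinates (S : Type*) where
  x : S → ℕ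
  y : S → ℕ
  y_injective : Function.Injective y
  x_lt_y : ∀ s, x s < y s
  x_ne_y : ∀ s t, x s ≠ y t

/-- The coordinates given by a column function `h` and an injection `e`: the values of `x` are
even and those of `y` are odd. -/
def Coordinates.ofInjective {S : Type*} (h e : S → ℕ) (he : Function.Injective e) :
    Coordinates S where
  x s := 2 * h s
  y s := 2 * Nat.pair (h s) (e s) + 1
  y_injective s t hst := by
    have h1 : Nat.pair (h s) (e s) = Nat.pair (h t) (e t) := by
      have : 2 * Nat.pair (h s) (e s) + 1 = 2 * Nat.pair (h t) (e t) + 1 := hst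
      omega
    exact he (Nat.pair_eq_pair.1 h1).2
  x_lt_y s := by
    have := Nat.left_le_pair (h s) (e s)
    omega
  x_ne_y s t := by omega

section

variable {S : Type*} (C : Coordinates S) (W : Ultrafilter S)

/-- The column function is neither finite-to-one nor constant on any set in `W`. -/
def Coordinates.IsStandard : Prop :=
  ∀ A ∈ W, ¬ FiniteToOneOn C.x A ∧ ¬ ConstantOn C.x A

/-- `H` has points in columns arbitrarily far to the right, and every column that meets `H` does
so in an infinite set. -/
def Coordinates.IsRich (H : Set S) : Prop :=
  (∀ N, ∃ t ∈ H, N < C.x t) ∧ ∀ s ∈ H, ∀ N, ∃ t ∈ H, C.x t = C.x s ∧ N < C.y t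

variable {C W}

theorem Coordinates.finite_y_le (N : ℕ) : {s | C.y s ≤ N}.Finite :=
  (Set.finite_Iic N).preimage C.y_injective.injOn

theorem Coordinates.IsStandard.eventually_lt_y (hC : C.IsStandard W) (F : ℕ → ℕ) :
    ∀ᶠ s in (W : Filter S), F (C.x s) < C.y s := by
  by_contra hcon
  rw [← Ultrafilter.eventually_not] at hcon
  refine (hC _ hcon).1 fun a => (C.finite_y_le (F a)).subset ?_
  rintro s ⟨hs, rfl⟩
  exact not_lt.1 hs

theorem Coordinates.IsStandard.eventually_lt_x (hC : C.IsStandard W) (N : ℕ) :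
    ∀ᶠ s in (W : Filter S), N < C.x s := by
  have h : ∀ a ∈ Set.Iic N, ∀ᶠ s in (W : Filter S), C.x s ≠ a := by
    intro a _
    by_contra hcon
    rw [← Ultrafilter.eventually_not] at hcon
    exact (hC _ hcon).2 ⟨a, fun s hs => not_not.1 hs⟩
  filter_upwards [(eventually_all_finite (Set.finite_Iic N)).2 h] with s hs
  by_contra hlt
  exact hs _ (not_lt.1 hlt) rfl

theorem Coordinates.IsStandard.exists_isRich (hC : C.IsStandard W) {H : Set S} (hH : H ∈ W) :
    ∃ H' ∈ W, H' ⊆ H ∧ C.IsRich H' := by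
  set H' : Set S := {s ∈ H | {t ∈ H | C.x t = C.x s}.Infinite} with hH'
  have hmem : H' ∈ W := by
    by_contra hcon
    rw [← Ultrafilter.compl_mem_iff_notMem] at hcon
    refine (hC _ (inter_mem hH hcon)).1 fun a => ?_
    by_cases hfin : {t ∈ H | C.x t = a}.Finite
    · exact hfin.subset fun t ht => ⟨ht.1.1, ht.2⟩
    · refine Set.Finite.subset Set.finite_empty ?_
      rintro t ⟨⟨htH, ht⟩, rfl⟩
      exact ht ⟨htH, hfin⟩
  refine ⟨H', hmem, fun s hs => hs.1, fun N => ?_, fun s hs N => ?_⟩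
  · obtain ⟨t, ht, htN⟩ := W.nonempty_of_mem (inter_mem hmem (hC.eventually_lt_x N))
    exact ⟨t, ht, htN⟩
  · by_contra hcon
    push Not at hcon
    refine hs.2 ((C.finite_y_le N).subset ?_)
    rintro t ⟨htH, hts⟩
    refine hcon t ⟨htH, ?_⟩ hts
    rw [hts]
    exact hs.2

end

/-! ### Types of tuples -/

section

variable {S : Type*} (C : Coordinates S) {n : ℕ}

/-- The values of the `2n` formal symbols at an `n`-tuple. -/
def Coordinates.sym (v : Fin n → S) : Fin n ⊕ Fin n → ℕ :=
  Sum.elim (C.x ∘ v) (C.y ∘ v)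

/-- The `n`-type of an `n`-tuple that is increasing in the coordinate `y`. -/
def Coordinates.type (v : Fin n → S) (hv : StrictMono (C.y ∘ v)) : NType n where
  le a b := C.sym v a ≤ C.sym v b
  refl _ := le_rfl
  trans _ _ _ := le_trans
  total _ _ := le_total _ _
  y_lt _ _ hij := ⟨(hv hij).le, not_le.2 (hv hij)⟩
  x_lt_y _ := ⟨(C.x_lt_y _).le, not_le.2 (C.x_lt_y _)⟩
  eq_or_x := by
    rintro (i | i) (j | j) h1 h2 h3
    · exact ⟨⟨i, rfl⟩, ⟨j, rfl⟩⟩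
    · exact absurd (le_antisymm h1 h2) (C.x_ne_y _ _)
    · exact absurd (le_antisymm h1 h2).symm (C.x_ne_y _ _)
    · exact absurd (congrArg Sum.inr (hv.injective (le_antisymm h1 h2))) h3

theorem NType.ext_le {τ τ' : NType n} (h : ∀ a b, τ.le a b ↔ τ'.le a b) : τ = τ' := by
  have : τ.le = τ'.le := by
    funext a b
    exact propext (h a b)
  cases τ
  cases τ'
  cases this
  rfl

theorem Coordinates.type_eq_iff {v w : Fin n → S} {hv : StrictMono (C.y ∘ v)}
    {hw : StrictMono (C.y ∘ w)} :
    C.type v hv = C.type w hw ↔ ∀ a b, C.sym v a ≤ C.sym v b ↔ C.sym w a ≤ C.sym w b := by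
  refine ⟨fun h a b => ?_, fun h => NType.ext_le h⟩
  exact iff_of_eq (congrFun (congrFun (congrArg NType.le h) a) b)

/-- The enumeration of an `n`-element set by increasing values of `y`. -/
noncomputable def Coordinates.enum (s : {s : Finset S // s.card = n}) : Fin n → S :=
  letI : LinearOrder S := LinearOrder.lift' C.y C.y_injective
  s.1.orderEmbOfFin s.2

theorem Coordinates.strictMono_enum (s : {s : Finset S // s.card = n}) :
    StrictMono (C.y ∘ C.enum s) := by
  let : LinearOrder S := LinearOrder.lift' C.y C.y_injective
  exact fun i j hij => (s.1.orderEmbOfFin s.2).strictMono hij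

theorem Coordinates.enum_mem (s : {s : Finset S // s.card = n}) (i : Fin n) : C.enum s i ∈ s.1 := by
  let : LinearOrder S := LinearOrder.lift' C.y C.y_injective
  exact s.1.orderEmbOfFin_mem s.2 i

/-- The set of entries of an injective tuple. -/
def tupleSet (v : Fin n → S) (hv : Function.Injective v) : {s : Finset S // s.card = n} :=
  ⟨Finset.univ.map ⟨v, hv⟩, by simp⟩

theorem tupleSet_subset {v : Fin n → S} (hv : Function.Injective v) {H : Set S}
    (hH : ∀ i, v i ∈ H) : ((tupleSet v hv).1 : Set S) ⊆ H := by
  intro s hs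
  obtain ⟨i, -, rfl⟩ := Finset.mem_map.1 (Finset.mem_coe.1 hs)
  exact hH i

theorem Coordinates.enum_tupleSet {v : Fin n → S} (hv : StrictMono (C.y ∘ v)) :
    C.enum (tupleSet v hv.injective.of_comp) = v := by
  let : LinearOrder S := LinearOrder.lift' C.y C.y_injective
  refine (Finset.orderEmbOfFin_unique (tupleSet v hv.injective.of_comp).2 (fun i => ?_) ?_).symm
  · exact Finset.mem_map.2 ⟨i, Finset.mem_univ i, rfl⟩
  · exact fun i j hij => hv hij

theorem Coordinates.tupleSet_enum (s : {s : Finset S // s.card = n}) :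
    tupleSet (C.enum s) (C.strictMono_enum s).injective.of_comp = s := by
  refine Subtype.ext (Finset.eq_of_subset_of_card_le (fun t ht => ?_) ?_)
  · obtain ⟨i, -, rfl⟩ := Finset.mem_map.1 ht
    exact C.enum_mem s i
  · rw [s.2, (tupleSet _ _).2]

variable (W : Ultrafilter S)

/-- Every property of increasing `n`-tuples is determined by their types on some set in `W`. -/
def Coordinates.IsHomogeneous (n : ℕ) : Prop :=
  ∀ R : (Fin n → S) → Prop, ∃ H ∈ W, ∀ (v w : Fin n → S) (hv : StrictMono (C.y ∘ v))
    (hw : StrictMono (C.y ∘ w)), (∀ i, v i ∈ H) → (∀ i, w i ∈ H) →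
      C.type v hv = C.type w hw → R v → R w

variable {C W}

theorem Coordinates.IsHomogeneous.isWeaklyRamsey (h : C.IsHomogeneous W n) :
    IsWeaklyRamsey W n (T n) := by
  intro k c
  choose H hHW hH using fun i : Fin k => h fun v => ∀ hv : Function.Injective v,
    c (tupleSet v hv) = i
  refine ⟨⋂ i, H i, iInter_mem.2 hHW, ?_⟩
  rw [T, ← Nat.card_coe_set_eq]
  choose s hsH hsc using fun i : {i : Fin k | ∃ s, (s.1 : Set S) ⊆ ⋂ i, H i ∧ c s = i} => i.2
  refine Nat.card_le_card_of_injective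
    (fun i => C.type (C.enum (s i)) (C.strictMono_enum (s i))) fun i j hij => ?_
  have hmem : ∀ i j l, C.enum (s i) l ∈ H j := fun i j l =>
    Set.mem_iInter.1 (hsH i (C.enum_mem (s i) l)) j
  have key := hH i.1 _ _ _ _ (hmem i i.1) (hmem j i.1) hij (fun hv => by
    rw [C.tupleSet_enum, hsc]) (C.strictMono_enum (s j)).injective.of_comp
  rw [C.tupleSet_enum, hsc] at key
  exact Subtype.ext key.symm

end

/-! ### Realizing types -/

namespace NType

variable {n : ℕ} (τ : NType n)

open Classical in
/-- The number of symbols that strictly precede `a`. -/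
noncomputable def rank (a : Fin n ⊕ Fin n) : ℕ :=
  (Finset.univ.filter fun b => ¬ τ.le a b).card

theorem le_iff_rank_le {a b : Fin n ⊕ Fin n} : τ.le a b ↔ τ.rank a ≤ τ.rank b := by
  constructor
  · intro h
    refine Finset.card_le_card fun c hc => ?_
    simp only [Finset.mem_filter, Finset.mem_univ, true_and] at hc ⊢
    exact fun hbc => hc (τ.trans _ _ _ h hbc)
  · intro h
    by_contra hab
    have hba := (τ.total a b).resolve_left hab
    refine absurd h (not_le.2 (Finset.card_lt_card ?_))
    refine Finset.ssubset_iff_of_subset (fun c hc => ?_) |>.2 ⟨b, ?_, ?_⟩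
    · simp only [Finset.mem_filter, Finset.mem_univ, true_and] at hc ⊢
      exact fun hac => hc (τ.trans _ _ _ hba hac)
    · simpa using hab
    · simpa using τ.refl b

theorem rank_inl_lt_inr (i : Fin n) : τ.rank (Sum.inl i) < τ.rank (Sum.inr i) := by
  rw [← not_le, ← le_iff_rank_le]
  exact (τ.x_lt_y i).2

theorem eq_inr_of_rank_eq {a : Fin n ⊕ Fin n} {i : Fin n} (h : τ.rank a = τ.rank (Sum.inr i)) :
    a = Sum.inr i := by
  by_contra hne
  obtain ⟨-, j, hj⟩ := τ.eq_or_x _ _ (τ.le_iff_rank_le.2 h.le) (τ.le_iff_rank_le.2 h.ge) hne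
  cases hj

theorem rank_lt (a : Fin n ⊕ Fin n) : τ.rank a < n + n + 1 := by
  refine Nat.lt_succ_of_le ((Finset.card_le_univ _).trans ?_)
  simp

end NType

section

variable {S : Type*} {C : Coordinates S} {n : ℕ}

/-- The values of the symbols are chosen in the order prescribed by the type: for a class of
symbols `xᵢ` a new column far to the right, and for a symbol `yᵢ` a point high up in the column
already chosen for `xᵢ`. -/
theorem Coordinates.IsRich.exists_partial {H : Set S} (hH : C.IsRich H) (τ : NType n) (k : ℕ) :
    ∃ φ : ℕ → ℕ, StrictMonoOn φ (Set.Iio k) ∧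
      (∀ i, τ.rank (Sum.inl i) < k → ∃ p ∈ H, φ (τ.rank (Sum.inl i)) = C.x p) ∧
      ∀ i, τ.rank (Sum.inr i) < k → ∃ p ∈ H, φ (τ.rank (Sum.inl i)) = C.x p ∧
        φ (τ.rank (Sum.inr i)) = C.y p := by
  induction k with
  | zero => exact ⟨id, by simp [StrictMonoOn], by simp, by simp⟩
  | succ k ih =>
    obtain ⟨φ, hmono, hx, hy⟩ := ih
    obtain ⟨N, hN⟩ : ∃ N, ∀ j < k, φ j ≤ N :=
      ⟨(Finset.range k).sup φ, fun j hj => Finset.le_sup (Finset.mem_range.2 hj)⟩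
    have hupd : ∀ M, N < M → StrictMonoOn (Function.update φ k M) (Set.Iio (k + 1)) := by
      intro M hM i hi j hj hij
      have hik : i < k := lt_of_lt_of_le hij (Nat.lt_succ_iff.1 hj)
      rw [Function.update_of_ne hik.ne]
      rcases (Nat.lt_succ_iff.1 hj).eq_or_lt with rfl | hjk
      · rw [Function.update_self]
        exact (hN i hik).trans_lt hM
      · rw [Function.update_of_ne hjk.ne]
        exact hmono hik hjk hij
    by_cases hk : ∃ i, τ.rank (Sum.inr i) = k
    · obtain ⟨i, rfl⟩ := hk
      have hi := τ.rank_inl_lt_inr i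
      obtain ⟨p, hpH, hp⟩ := hx i hi
      obtain ⟨t, htH, htx, hty⟩ := hH.2 p hpH N
      refine ⟨Function.update φ _ (C.y t), hupd _ hty, fun j hj => ?_, fun j hj => ?_⟩
      · have hne : τ.rank (Sum.inl j) ≠ τ.rank (Sum.inr i) := fun h => by
          cases τ.eq_inr_of_rank_eq h
        rw [Function.update_of_ne hne]
        exact hx j (lt_of_le_of_ne (Nat.lt_succ_iff.1 hj) hne)
      · rcases (Nat.lt_succ_iff.1 hj).eq_or_lt with h | h
        · cases τ.eq_inr_of_rank_eq h
          refine ⟨t, htH, ?_, Function.update_self ..⟩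
          rw [Function.update_of_ne hi.ne, hp, htx]
        · rw [Function.update_of_ne h.ne, Function.update_of_ne ((τ.rank_inl_lt_inr j).trans h).ne]
          exact hy j h
    · push Not at hk
      obtain ⟨t, htH, ht⟩ := hH.1 N
      refine ⟨Function.update φ _ (C.x t), hupd _ ht, fun j hj => ?_, fun j hj => ?_⟩
      · rcases (Nat.lt_succ_iff.1 hj).eq_or_lt with h | h
        · exact ⟨t, htH, by rw [h, Function.update_self]⟩
        · rw [Function.update_of_ne h.ne]
          exact hx j h
      · have h := lt_of_le_of_ne (Nat.lt_succ_iff.1 hj) (hk j)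
        rw [Function.update_of_ne h.ne, Function.update_of_ne ((τ.rank_inl_lt_inr j).trans h).ne]
        exact hy j h

theorem Coordinates.IsRich.exists_type_eq {H : Set S} (hH : C.IsRich H) (τ : NType n) :
    ∃ (v : Fin n → S) (hv : StrictMono (C.y ∘ v)), (∀ i, v i ∈ H) ∧ C.type v hv = τ := by
  obtain ⟨φ, hmono, -, hy⟩ := hH.exists_partial τ (n + n + 1)
  choose v hvH hvx hvy using fun i => hy i (τ.rank_lt _)
  have hsym : ∀ a, C.sym v a = φ (τ.rank a) := by
    rintro (i | i)
    · exact (hvx i).symm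
    · exact (hvy i).symm
  have hle : ∀ a b, C.sym v a ≤ C.sym v b ↔ τ.le a b := fun a b => by
    rw [hsym, hsym, hmono.le_iff_le (τ.rank_lt a) (τ.rank_lt b), τ.le_iff_rank_le]
  refine ⟨v, fun i j hij => ?_, hvH, NType.ext_le hle⟩
  rw [← not_le]
  exact fun h => (τ.y_lt i j hij).2 ((hle (Sum.inr j) (Sum.inr i)).1 h)

/-- Since every set in `W` realizes all `T n` types, a set that meets only `T n` classes of a
partition refining the partition into types meets exactly one class for each type. -/
theorem Coordinates.IsStandard.isHomogeneous {W : Ultrafilter S} (hC : C.IsStandard W)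
    (h : IsWeaklyRamsey W n (T n)) : C.IsHomogeneous W n := by
  intro R
  let e := Finite.equivFin (Prop × NType n)
  obtain ⟨H, hHW, hH⟩ := h _ fun s => e (R (C.enum s), C.type (C.enum s) (C.strictMono_enum s))
  obtain ⟨H', hH'W, hH'H, hrich⟩ := hC.exists_isRich hHW
  set I := {i | ∃ s : {s : Finset S // s.card = n}, (s.1 : Set S) ⊆ H ∧
    e (R (C.enum s), C.type (C.enum s) (C.strictMono_enum s)) = i} with hI
  have hmem : ∀ (v : Fin n → S) (hv : StrictMono (C.y ∘ v)), (∀ i, v i ∈ H') →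
      e (R v, C.type v hv) ∈ I := by
    intro v hv hvH
    refine ⟨tupleSet v hv.injective.of_comp, tupleSet_subset _ fun i => hH'H (hvH i), ?_⟩
    simp only [C.enum_tupleSet hv]
  let p : I → NType n := fun i => (e.symm i.1).2
  have hsurj : Function.Surjective p := by
    intro τ
    obtain ⟨v, hv, hvH, rfl⟩ := hrich.exists_type_eq τ
    exact ⟨⟨_, hmem v hv hvH⟩, by simp [p]⟩
  have hinj : Function.Injective p := by
    refine (hsurj.bijective_of_nat_card_le ?_).1
    rw [Nat.card_coe_set_eq]
    exact hH
  refine ⟨H', hH'W, fun v w hv hw hvH hwH hvw hR => ?_⟩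
  have h1 : (⟨_, hmem v hv hvH⟩ : I) = ⟨_, hmem w hw hwH⟩ := hinj (by simpa [p] using hvw)
  have h2 := (Prod.ext_iff.1 (e.injective (Subtype.ext_iff.1 h1))).1
  exact (iff_of_eq h2).1 hR

end

/-! ### Pairs -/

section

variable {S : Type*} (C : Coordinates S)

/-- The pairs `(s, t)` and `(s', t')`, both increasing in `y`, have the same `2`-type. -/
def Coordinates.SameType (s t s' t' : S) : Prop :=
  (C.x s < C.x t ↔ C.x s' < C.x t') ∧ (C.x t < C.x s ↔ C.x t' < C.x s') ∧
    (C.x t < C.y s ↔ C.x t' < C.y s')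

variable {C} {W : Ultrafilter S} {n : ℕ}

/-- A pair extends to an infinite sequence each of whose further points lies, together with its
column, beyond the preceding point. -/
theorem Coordinates.IsRich.exists_extension {H : Set S} (hH : C.IsRich H) {s t : S} (hs : s ∈ H)
    (ht : t ∈ H) (hst : C.y s < C.y t) :
    ∃ w : ℕ → S, w 0 = s ∧ w 1 = t ∧ (∀ i, w i ∈ H) ∧ StrictMono (C.y ∘ w) ∧
      ∀ i j, i < j → 2 ≤ j → C.y (w i) < C.x (w j) := by
  choose next hnextH hnext using hH.1
  let u : ℕ → S := fun i => Nat.rec t (fun _ p => next (C.y p)) i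
  let w : ℕ → S := fun i => Nat.casesOn i s u
  have hu : ∀ i, C.y (u i) < C.x (u (i + 1)) := fun i => hnext _
  have hmono : StrictMono (C.y ∘ w) := by
    refine strictMono_nat_of_lt_succ fun i => ?_
    cases i with
    | zero => exact hst
    | succ i => exact (hu i).trans (C.x_lt_y _)
  refine ⟨w, rfl, rfl, fun i => ?_, hmono, fun i j hij hj => ?_⟩
  · rcases i with _ | _ | i
    · exact hs
    · exact ht
    · exact hnextH _
  · obtain ⟨j, rfl⟩ : ∃ k, j = k + 2 := ⟨j - 2, by omega⟩
    exact (hmono.monotone (show i ≤ j + 1 by omega)).trans_lt (hu j)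

/-- A colouring of pairs, regarded as a colouring of `n`-tuples through their first two entries,
is determined by the `2`-type because all pairs extend to `n`-tuples in the same way. -/
theorem Coordinates.IsStandard.exists_pair_homogeneous (hC : C.IsStandard W)
    (h : C.IsHomogeneous W n) (hn : 2 ≤ n) (R : S → S → Prop) :
    ∃ H ∈ W, C.IsRich H ∧ ∀ s t s' t', s ∈ H → t ∈ H → s' ∈ H → t' ∈ H → C.y s < C.y t →
      C.y s' < C.y t' → C.SameType s t s' t' → R s t → R s' t' := by
  obtain ⟨H, hHW, hH⟩ := h fun v => R (v ⟨0, by omega⟩) (v ⟨1, by omega⟩)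
  obtain ⟨H', hH'W, hH'H, hrich⟩ := hC.exists_isRich hHW
  refine ⟨H', hH'W, hrich, fun s t s' t' hs ht hs' ht' hst hst' ⟨h1, h2, h3⟩ hR => ?_⟩
  obtain ⟨w, rfl, rfl, hwH, hw, hwx⟩ := hrich.exists_extension hs ht hst
  obtain ⟨w', rfl, rfl, hwH', hw', hwx'⟩ := hrich.exists_extension hs' ht' hst'
  refine hH (fun i : Fin n => w i) (fun i : Fin n => w' i) (fun i j hij => hw hij)
    (fun i j hij => hw' hij) (fun i => hH'H (hwH i)) (fun i => hH'H (hwH' i))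
    (C.type_eq_iff.2 fun a b => ?_) hR
  have key : ∀ i j : ℕ, (C.x (w i) ≤ C.x (w j) ↔ C.x (w' i) ≤ C.x (w' j)) ∧
      (C.x (w i) ≤ C.y (w j) ↔ C.x (w' i) ≤ C.y (w' j)) ∧
      (C.y (w i) ≤ C.x (w j) ↔ C.y (w' i) ≤ C.x (w' j)) ∧
      (C.y (w i) ≤ C.y (w j) ↔ C.y (w' i) ≤ C.y (w' j)) := by
    intro i j
    have a1 := C.x_lt_y (w i)
    have a2 := C.x_lt_y (w j)
    have a3 := C.x_lt_y (w' i)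
    have a4 := C.x_lt_y (w' j)
    rcases lt_trichotomy i j with hij | rfl | hij
    · by_cases hj : 2 ≤ j
      · have b1 := hwx i j hij hj
        have b2 := hwx' i j hij hj
        omega
      · obtain ⟨rfl, rfl⟩ : i = 0 ∧ j = 1 := by omega
        have b1 := C.x_ne_y (w 1) (w 0)
        have b2 := C.x_ne_y (w' 1) (w' 0)
        omega
    · omega
    · by_cases hi : 2 ≤ i
      · have b1 := hwx j i hij hi
        have b2 := hwx' j i hij hi
        omega
      · obtain ⟨rfl, rfl⟩ : j = 0 ∧ i = 1 := by omega
        have b1 := C.x_ne_y (w 1) (w 0)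
        have b2 := C.x_ne_y (w' 1) (w' 0)
        omega
  rcases a with i | i <;> rcases b with j | j
  · exact (key i j).1
  · exact (key i j).2.1
  · exact (key i j).2.2.1
  · exact (key i j).2.2.2

end

/-! ### The three-functions property and conservativity in coordinates -/

section

variable {S : Type*} (C : Coordinates S) (W : Ultrafilter S)

/-- The three-functions property for the column function `x`. -/
def Coordinates.HasThreeFunctions : Prop :=
  ∀ f : S → ℕ, ∃ A ∈ W, ConstantOn f A ∨ Set.InjOn f A ∨
    ∀ s ∈ A, ∀ t ∈ A, f s = f t ↔ C.x s = C.x t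

/-- Conservativity of the column function `x`, in terms of representatives: the trace of every
internal set `[X]` on the functions of the column is given by an internal set `[Y]` there. -/
def Coordinates.IsConservative : Prop :=
  ∀ X : S → Set ℕ, ∃ Y : ℕ → Set ℕ, ∀ g : ℕ → ℕ, ∀ᶠ s in (W : Filter S),
    g (C.x s) ∈ X s ↔ g (C.x s) ∈ Y (C.x s)

variable {C W} {n : ℕ}

/-- The equation `f s = f t` depends only on the type of the pair `(s, t)`. If it holds for some
type of pairs in different columns, then it links a pair with `y s < x t`, hence all such pairs,
and `f` is constant. Otherwise it depends on whether it holds within columns. -/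
theorem Coordinates.IsStandard.hasThreeFunctions (hC : C.IsStandard W)
    (h : C.IsHomogeneous W n) (hn : 2 ≤ n) : C.HasThreeFunctions W := by
  intro f
  obtain ⟨H, hHW, hrich, hH⟩ := hC.exists_pair_homogeneous h hn fun s t => f s = f t
  refine ⟨H, hHW, ?_⟩
  have hxy := C.x_lt_y
  by_cases hD : ∃ s ∈ H, ∃ t ∈ H, C.y s < C.x t ∧ f s = f t
  · left
    obtain ⟨s, hs, t, ht, hst, hf⟩ := hD
    have hall : ∀ s' ∈ H, ∀ t' ∈ H, C.y s' < C.x t' → f s' = f t' := by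
      intro s' hs' t' ht' hst'
      have := hxy s
      have := hxy t
      have := hxy s'
      have := hxy t'
      exact hH s t s' t' hs ht hs' ht' (by omega) (by omega)
        ⟨by omega, by omega, by omega⟩ hf
    refine ⟨f s, fun p hp => ?_⟩
    obtain ⟨u, hu, hlt⟩ := hrich.1 (max (C.y s) (C.y p))
    rw [hall p hp u hu ((le_max_right _ _).trans_lt hlt),
      hall s hs u hu ((le_max_left _ _).trans_lt hlt)]
  right
  push Not at hD
  have hC' : ∀ s ∈ H, ∀ t ∈ H, C.y s < C.y t → C.x t < C.x s → f s ≠ f t := by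
    intro s hs t ht hst hx hf
    -- a point `q` high up in the column of `t` links `s` to a point `p` far to the right of it
    obtain ⟨p, hp, hpx⟩ := hrich.1 (C.y s)
    obtain ⟨q, hq, hqx, hqy⟩ := hrich.2 t ht (C.y p)
    have := hxy s
    have := hxy p
    have h1 := hH s t s q hs ht hs hq hst (by omega) ⟨by omega, by omega, by omega⟩ hf
    have h2 := hH s t p q hs ht hp hq hst (by omega) ⟨by omega, by omega, by omega⟩ hf
    exact hD s hs p hp hpx (h1.trans h2.symm)
  have hB : ∀ s ∈ H, ∀ t ∈ H, C.y s < C.y t → C.x s < C.x t → f s ≠ f t := by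
    intro s hs t ht hst hx hf
    rcases lt_or_ge (C.y s) (C.x t) with hlt | hge
    · exact hD s hs t ht hlt hf
    have hne := C.x_ne_y t s
    have hall : ∀ s' ∈ H, ∀ t' ∈ H, C.x s' < C.x t' → C.x t' < C.y s' → C.y s' < C.y t' →
        f s' = f t' := by
      intro s' hs' t' ht' h1 h2 h3
      exact hH s t s' t' hs ht hs' ht' hst h3 ⟨by omega, by omega, by omega⟩ hf
    -- column `x s` links `t` to a point `q` beyond it, by way of another point of column `x t`
    obtain ⟨b, hb, hbx⟩ := hrich.1 (C.y t)
    obtain ⟨s₂, hs₂, hs₂x, hs₂y⟩ := hrich.2 s hs (C.x b)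
    obtain ⟨q, hq, hqx, hqy⟩ := hrich.2 b hb (C.y s₂)
    obtain ⟨t', ht', ht'x, ht'y⟩ := hrich.2 t ht (C.y s₂)
    have := hxy t
    have e1 := hall s hs t' ht' (by omega) (by omega) (by omega)
    have e2 := hall s₂ hs₂ t' ht' (by omega) (by omega) (by omega)
    have e3 := hall s₂ hs₂ q hq (by omega) (by omega) (by omega)
    exact hD t ht q hq (by omega) (hf.symm.trans (e1.trans (e2.symm.trans e3)))
  have hne : ∀ s ∈ H, ∀ t ∈ H, f s = f t → C.x s = C.x t := by
    intro s hs t ht hf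
    by_contra hx
    have hy : C.y s ≠ C.y t := fun h => hx (by rw [C.y_injective h])
    rcases lt_or_gt_of_ne hx with hx | hx <;> rcases lt_or_gt_of_ne hy with hy | hy
    · exact hB s hs t ht hy hx hf
    · exact hC' t ht s hs hy hx hf.symm
    · exact hC' s hs t ht hy hx hf
    · exact hB t ht s hs hy hx hf.symm
  by_cases hA : ∃ s ∈ H, ∃ t ∈ H, C.y s < C.y t ∧ C.x s = C.x t ∧ f s = f t
  · right
    obtain ⟨s, hs, t, ht, hst, hx, hf⟩ := hA
    have hall : ∀ s' ∈ H, ∀ t' ∈ H, C.y s' < C.y t' → C.x s' = C.x t' → f s' = f t' := by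
      intro s' hs' t' ht' h1 h2
      have := hxy s
      have := hxy s'
      exact hH s t s' t' hs ht hs' ht' hst h1 ⟨by omega, by omega, by omega⟩ hf
    intro s' hs' t' ht'
    refine ⟨hne s' hs' t' ht', fun hx' => ?_⟩
    rcases lt_trichotomy (C.y s') (C.y t') with hy | hy | hy
    · exact hall s' hs' t' ht' hy hx'
    · rw [C.y_injective hy]
    · exact (hall t' ht' s' hs' hy hx'.symm).symm
  · left
    push Not at hA
    intro s hs t ht hf
    have hx := hne s hs t ht hf
    rcases lt_trichotomy (C.y s) (C.y t) with hy | hy | hy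
    · exact absurd hf (hA s hs t ht hy hx)
    · exact C.y_injective hy
    · exact absurd hf.symm (hA t ht s hs hy hx.symm)

/-- The lexicographic order of the sets `X s` is monotone along each column of a homogeneous set,
so that `X s` converges to a set `Y a` as `s` runs through the column `a`. -/
theorem Coordinates.IsStandard.isConservative (hC : C.IsStandard W)
    (h : C.IsHomogeneous W n) (hn : 2 ≤ n) : C.IsConservative W := by
  intro X
  obtain ⟨H, hHW, hrich, hH⟩ := hC.exists_pair_homogeneous h hn
    fun s t => ∃ m, m ∉ X s ∧ m ∈ X t ∧ ∀ i < m, i ∈ X s ↔ i ∈ X t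
  have hsame : ∀ s t s' t', C.x s = C.x t → C.x s' = C.x t' → C.SameType s t s' t' := by
    intro s t s' t' h1 h2
    have := C.x_lt_y s
    have := C.x_lt_y s'
    exact ⟨by omega, by omega, by omega⟩
  have hstable : ∀ a m, ∃ N, ∀ i < m, ∀ s ∈ H, ∀ t ∈ H, C.x s = a → C.x t = a → N < C.y s →
      N < C.y t → i ∈ X s → i ∈ X t := by
    intro a m
    induction m with
    | zero => exact ⟨0, by simp⟩
    | succ m ih =>
      obtain ⟨N, hN⟩ := ih
      suffices h : ∃ N' ≥ N, ∀ s ∈ H, ∀ t ∈ H, C.x s = a → C.x t = a → N' < C.y s →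
          N' < C.y t → m ∈ X s → m ∈ X t by
        obtain ⟨N', hN', h⟩ := h
        refine ⟨N', fun i hi s hs t ht hsa hta hsN htN => ?_⟩
        rcases (Nat.lt_succ_iff.1 hi).eq_or_lt with rfl | hi
        · exact h s hs t ht hsa hta hsN htN
        · exact hN i hi s hs t ht hsa hta (by omega) (by omega)
      by_cases hlex : ∃ s ∈ H, ∃ t ∈ H, C.x s = C.x t ∧ C.y s < C.y t ∧
          ∃ m, m ∉ X s ∧ m ∈ X t ∧ ∀ i < m, i ∈ X s ↔ i ∈ X t
      · -- the sets increase along the column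
        obtain ⟨p, hp, q, hq, hpqx, hpqy, hpq⟩ := hlex
        have hinc : ∀ s ∈ H, ∀ t ∈ H, C.x s = a → C.x t = a → N < C.y s → C.y s < C.y t →
            m ∈ X s → m ∈ X t := by
          intro s hs t ht hsa hta hsN hst hms
          by_contra hmt
          obtain ⟨j, hj1, hj2, hj3⟩ := hH p q s t hp hq hs ht hpqy hst
            (hsame _ _ _ _ hpqx (hsa.trans hta.symm)) hpq
          rcases lt_trichotomy j m with hjm | rfl | hjm
          · exact hj1 (hN j hjm t ht s hs hta hsa (by omega) hsN hj2)
          · exact hj1 hms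
          · exact hmt ((hj3 m hjm).1 hms)
        by_cases hex : ∃ p ∈ H, C.x p = a ∧ N < C.y p ∧ m ∈ X p
        · obtain ⟨p, hp, hpa, hpN, hpm⟩ := hex
          exact ⟨C.y p, hpN.le, fun s _ t ht _ hta _ htN _ =>
            hinc p hp t ht hpa hta hpN htN hpm⟩
        · push Not at hex
          exact ⟨N, le_rfl, fun s hs t _ hsa _ hsN _ hm => absurd hm (hex s hs hsa hsN)⟩
      · -- the sets decrease along the column
        push Not at hlex
        have hdec : ∀ s ∈ H, ∀ t ∈ H, C.x s = a → C.x t = a → N < C.y s → C.y s < C.y t →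
            m ∉ X s → m ∉ X t := by
          intro s hs t ht hsa hta hsN hst hms hmt
          obtain ⟨i, hi, hne⟩ := hlex s hs t ht (hsa.trans hta.symm) hst m hms hmt
          have h1 := hN i hi s hs t ht hsa hta hsN (by omega)
          have h2 := hN i hi t ht s hs hta hsa (by omega) hsN
          tauto
        by_cases hex : ∃ p ∈ H, C.x p = a ∧ N < C.y p ∧ m ∉ X p
        · obtain ⟨p, hp, hpa, hpN, hpm⟩ := hex
          exact ⟨C.y p, hpN.le, fun s hs t _ hsa _ hsN _ hm =>
            absurd hm (hdec p hp s hs hpa hsa hpN hsN hpm)⟩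
        · push Not at hex
          exact ⟨N, le_rfl, fun s _ t ht _ hta _ htN _ => hex t ht hta htN⟩
  choose N hN using hstable
  refine ⟨fun a => {m | ∃ N, ∀ s ∈ H, C.x s = a → N < C.y s → m ∈ X s}, fun g => ?_⟩
  filter_upwards [hHW, hC.eventually_lt_y fun a => N a (g a + 1)] with s hs hsN
  constructor
  · intro hm
    exact ⟨N (C.x s) (g (C.x s) + 1), fun t ht htx htN =>
      hN _ _ _ (Nat.lt_succ_self _) s hs t ht rfl htx hsN htN hm⟩
  · rintro ⟨M, hM⟩
    obtain ⟨t, ht, htx, hty⟩ := hrich.2 s hs (max M (N (C.x s) (g (C.x s) + 1)))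
    exact hN _ _ _ (Nat.lt_succ_self _) t ht s hs htx rfl ((le_max_right _ _).trans_lt hty) hsN
      (hM t ht htx ((le_max_left _ _).trans_lt hty))

end

/-! ### Sparse sets and diagonalization -/

section

variable {S : Type*} (C : Coordinates S)

/-- The set of all values of the two coordinates on `H`. -/
def Coordinates.values (H : Set S) : Set ℕ :=
  C.x '' H ∪ C.y '' H

variable {C} {W : Ultrafilter S}

theorem Coordinates.values_mono {H H' : Set S} (h : H ⊆ H') : C.values H ⊆ C.values H' :=
  Set.union_subset_union (Set.image_mono h) (Set.image_mono h)

/-- A finite-to-one function is injective on the values of `x`, and on the values of `y`, by the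
three-functions property. If `f ∘ x` and `f ∘ y` mapped `W` to the same ultrafilter, then the
column function would be carried along `f ∘ y` to a function on it that is neither constant nor
injective on any large set, whereas every function on the image of `W` under `f ∘ x` is one or the
other on some large set. -/
theorem Coordinates.IsStandard.exists_injOn_values (hC : C.IsStandard W)
    (h3 : C.HasThreeFunctions W) {f : ℕ → ℕ} (hf : ∀ N, {z | f z = N}.Finite) :
    ∃ H ∈ W, Set.InjOn f (C.values H) := by
  have hxinj : ∀ A ∈ W, ¬ Set.InjOn C.x A := fun A hA hinj =>
    (hC A hA).1 fun a => Set.Subsingleton.finite fun s hs t ht =>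
      hinj hs.1 ht.1 (hs.2.trans ht.2.symm)
  have hcol : ∀ A ∈ W, ∀ g : S → ℕ, (∀ N, {s ∈ A | g s = N}.Finite) →
      ¬ ∀ s ∈ A, ∀ t ∈ A, g s = g t ↔ C.x s = C.x t := by
    intro A hA g hg hgx
    refine (hC A hA).1 fun a => ?_
    by_cases hex : ∃ s ∈ A, C.x s = a
    · obtain ⟨s, hs, rfl⟩ := hex
      exact (hg (g s)).subset fun t ht => ⟨ht.1, (hgx t ht.1 s hs).2 ht.2⟩
    · exact Set.Finite.subset Set.finite_empty fun t ht => hex ⟨t, ht⟩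
  have hconst : ∀ A ∈ W, ∀ g : S → ℕ, (∀ N, {s ∈ A | g s = N}.Finite) → ¬ ConstantOn g A := by
    rintro A hA g hg ⟨N, hN⟩
    exact (hC A hA).1 fun a => (hg N).subset fun t ht => ⟨ht.1, hN t ht.1⟩
  have hfy : ∀ A : Set S, ∀ N, {s ∈ A | f (C.y s) = N}.Finite := fun A N =>
    ((hf N).preimage C.y_injective.injOn).subset fun s hs => hs.2
  obtain ⟨A, hA, hAy⟩ : ∃ A ∈ W, Set.InjOn (fun s => f (C.y s)) A := by
    obtain ⟨A, hA, h | h | h⟩ := h3 fun s => f (C.y s)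
    · exact absurd h (hconst A hA _ (hfy A))
    · exact ⟨A, hA, h⟩
    · exact absurd h (hcol A hA _ (hfy A))
  obtain ⟨B, hB, hBx⟩ : ∃ B ∈ W, ∀ s ∈ B, ∀ t ∈ B, f (C.x s) = f (C.x t) ↔ C.x s = C.x t := by
    obtain ⟨B, hB, ⟨N, hN⟩ | h | h⟩ := h3 fun s => f (C.x s)
    · obtain ⟨M, hM⟩ := (hf N).bddAbove
      obtain ⟨s, hs, hsM⟩ := W.nonempty_of_mem (inter_mem hB (hC.eventually_lt_x M))
      exact absurd (hM (hN s hs)) (not_le.2 hsM)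
    · exact absurd (fun s hs t ht hst => h hs ht (congrArg f hst)) (hxinj B hB)
    · exact ⟨B, hB, h⟩
  obtain ⟨D, hD, hDne⟩ : ∃ D ∈ W, ∀ s ∈ D, ∀ t ∈ D, f (C.x s) ≠ f (C.y t) := by
    by_contra hcon
    push Not at hcon
    have heq : ∀ Z : Set ℕ, (∀ᶠ s in (W : Filter S), f (C.x s) ∈ Z) →
        ∀ᶠ s in (W : Filter S), f (C.y s) ∈ Z := by
      intro Z hZ
      by_contra hZ'
      rw [← Ultrafilter.eventually_not] at hZ'
      obtain ⟨s, hs, t, ht, hst⟩ := hcon _ (hZ.and hZ')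
      exact ht.2 (hst ▸ hs.1)
    -- `p` is the column function carried along `f ∘ y`
    classical
    let p : ℕ → ℕ := fun z => if h : ∃ s ∈ A, f (C.y s) = z then C.x h.choose else 0
    have hp : ∀ s ∈ A, p (f (C.y s)) = C.x s := by
      intro s hs
      have hex : ∃ t ∈ A, f (C.y t) = f (C.y s) := ⟨s, hs, rfl⟩
      have : p (f (C.y s)) = C.x hex.choose := dif_pos hex
      rw [this, hAy hex.choose_spec.1 hs hex.choose_spec.2]
    obtain ⟨E, hE, hEp⟩ := h3 fun s => p (f (C.x s))
    have hEy : {s | f (C.y s) ∈ (fun s => f (C.x s)) '' (E ∩ B)} ∩ A ∈ W :=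
      inter_mem (heq _ (mem_of_superset (inter_mem hE hB) fun s hs => ⟨s, hs, rfl⟩)) hA
    rcases hEp with ⟨N, hN⟩ | h | h
    · refine (hC _ hEy).2 ⟨N, ?_⟩
      rintro s ⟨⟨t, ht, hts⟩, hsA⟩
      rw [← hp s hsA, ← hts]
      exact hN t ht.1
    · exact hxinj E hE fun s hs t ht hst => h hs ht (by simp only [hst])
    · refine hxinj _ hEy ?_
      rintro s ⟨⟨s', hs', hs's⟩, hsA⟩ t ⟨⟨t', ht', ht't⟩, htA⟩ hst
      refine hAy hsA htA ?_
      change f (C.y s) = f (C.y t)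
      rw [← hs's, ← ht't, hBx s' hs'.2 t' ht'.2, ← h s' hs'.1 t' ht'.1]
      change p ((fun s => f (C.x s)) s') = p ((fun s => f (C.x s)) t')
      rw [hs's, ht't, hp s hsA, hp t htA, hst]
  refine ⟨A ∩ B ∩ D, inter_mem (inter_mem hA hB) hD, ?_⟩
  rintro _ (⟨s, hs, rfl⟩ | ⟨s, hs, rfl⟩) _ (⟨t, ht, rfl⟩ | ⟨t, ht, rfl⟩) hst
  · exact (hBx s hs.1.2 t ht.1.2).1 hst
  · exact absurd hst (hDne s hs.2 t ht.2)
  · exact absurd hst.symm (hDne t ht.2 s hs.2)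
  · rw [hAy hs.1.1 ht.1.1 hst]

/-- Some set in `W` has its values as far apart as prescribed: they lie in distinct and
nonadjacent blocks of an interval partition of `ℕ` that outgrows `F`. -/
theorem Coordinates.IsStandard.exists_sparse (hC : C.IsStandard W) (h3 : C.HasThreeFunctions W)
    (F : ℕ → ℕ) :
    ∃ H ∈ W, ∀ z ∈ C.values H, ∀ z' ∈ C.values H, z < z' → F z < z' := by
  let G : ℕ → ℕ := fun N => N + 1 + (Finset.range (N + 1)).sup F
  let k : ℕ → ℕ := fun i => G^[i] 0
  have hG : ∀ N z, z ≤ N → F z < G N := fun N z hz => by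
    have : F z ≤ (Finset.range (N + 1)).sup F :=
      Finset.le_sup (Finset.mem_range.2 (Nat.lt_succ_of_le hz))
    simp only [G]
    omega
  have hks : ∀ i, k (i + 1) = G (k i) := fun i => Function.iterate_succ_apply' G i 0
  have hk : StrictMono k := strictMono_nat_of_lt_succ fun i => by
    rw [hks]
    exact (Nat.lt_succ_self _).trans_le (Nat.le_add_right _ _)
  have hex : ∀ z : ℕ, ∃ i : ℕ, z < k i := fun z => ⟨z + 1, hk.le_apply⟩
  -- `β z` is the index of the block of `z`
  let β : ℕ → ℕ := fun z => Nat.find (hex z)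
  have hβ : ∀ z, z < k (β z) := fun z => Nat.find_spec (hex z)
  have hβ' : ∀ z i, i < β z → k i ≤ z := fun z i hi =>
    not_lt.1 (Nat.find_min (p := fun i => z < k i) (hex z) hi)
  have hfin : ∀ N, {z | β z ≤ N}.Finite := fun N =>
    (Set.finite_Iio (k N)).subset fun z hz => (hβ z).trans_le (hk.monotone hz)
  -- two values in adjacent blocks are identified by one of the two ways to merge blocks in pairs
  obtain ⟨H₁, hH₁, hinj₁⟩ := hC.exists_injOn_values h3 (f := fun z => β z / 2)
    fun N => (hfin (2 * N + 1)).subset fun z (hz : β z / 2 = N) => by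
      change β z ≤ 2 * N + 1
      omega
  obtain ⟨H₂, hH₂, hinj₂⟩ := hC.exists_injOn_values h3 (f := fun z => (β z + 1) / 2)
    fun N => (hfin (2 * N + 1)).subset fun z (hz : (β z + 1) / 2 = N) => by
      change β z ≤ 2 * N + 1
      omega
  refine ⟨H₁ ∩ H₂, inter_mem hH₁ hH₂, fun z hz z' hz' hlt => ?_⟩
  have hmono : β z ≤ β z' := by
    by_contra hcon
    exact absurd (hβ' z _ (not_le.1 hcon)) (not_le.2 (hlt.trans (hβ z')))
  have h1 : β z / 2 ≠ β z' / 2 := fun h => hlt.ne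
    (hinj₁ (values_mono Set.inter_subset_left hz) (values_mono Set.inter_subset_left hz') h)
  have h2 : (β z + 1) / 2 ≠ (β z' + 1) / 2 := fun h => hlt.ne
    (hinj₂ (values_mono Set.inter_subset_right hz) (values_mono Set.inter_subset_right hz') h)
  exact (hG _ z (hβ z).le).trans_le (hks _ ▸ hβ' z' (β z + 1) (by omega))

/-- Let `p` be one of the coordinates, and suppose that `p s` is bounded on `{s | ℓ s ≤ m}` for
every `m`. Then on a sufficiently sparse set the values below `p s` are below `ℓ s`. -/
theorem Coordinates.IsStandard.exists_lt_of_bddAbove (hC : C.IsStandard W)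
    (h3 : C.HasThreeFunctions W) (ℓ p : S → ℕ) (hp : ∀ H, ∀ s ∈ H, p s ∈ C.values H)
    {A : Set S} (hA : A ∈ W) (hbdd : ∀ m, BddAbove (p '' {s ∈ A | ℓ s ≤ m})) :
    ∃ H ∈ W, ∀ s ∈ H, ∀ z ∈ C.values H, z < p s → z < ℓ s := by
  choose F hF using hbdd
  obtain ⟨H, hH, hsparse⟩ := hC.exists_sparse h3 F
  refine ⟨H ∩ A, inter_mem hH hA, fun s hs z hz hlt => ?_⟩
  by_contra hcon
  exact absurd (hF z ⟨s, ⟨hs.2, not_lt.1 hcon⟩, rfl⟩)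
    (not_le.2 (hsparse z (values_mono Set.inter_subset_left hz) _ (hp _ s hs.1) hlt))

theorem mem_values_x (H : Set S) : ∀ s ∈ H, C.x s ∈ C.values H :=
  fun s hs => Or.inl ⟨s, hs, rfl⟩

theorem mem_values_y (H : Set S) : ∀ s ∈ H, C.y s ∈ C.values H :=
  fun s hs => Or.inr ⟨s, hs, rfl⟩

theorem bddAbove_image_of_injOn {ℓ p : S → ℕ} {A : Set S} (h : Set.InjOn ℓ A) (m : ℕ) :
    BddAbove (p '' {s ∈ A | ℓ s ≤ m}) := by
  refine (Set.Finite.image _ ?_).bddAbove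
  exact Set.Finite.of_finite_image ((Set.finite_Iic m).subset (by rintro _ ⟨s, hs, rfl⟩; exact hs.2))
    (h.mono fun s hs => hs.1)

/-- The first index at which `s` leaves the sets `B`, or a value beyond `y s` if there is none. -/
theorem exists_exit_index (B : ℕ → Set S) :
    ∃ ℓ : S → ℕ, (∀ s, ∀ z < ℓ s, z ≤ C.y s → s ∈ B z) ∧
      ∀ s N, N < C.y s → (∀ M ≤ N, s ∈ B M) → N < ℓ s := by
  have : ∀ s, ∃ ℓ, (∀ z < ℓ, z ≤ C.y s → s ∈ B z) ∧
      ∀ N, N < C.y s → (∀ M ≤ N, s ∈ B M) → N < ℓ := by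
    intro s
    classical
    by_cases hex : ∃ z, s ∉ B z
    · refine ⟨Nat.find hex, fun z hz _ => not_not.1 (Nat.find_min hex hz), fun N _ hN => ?_⟩
      by_contra hcon
      exact Nat.find_spec hex (hN _ (not_lt.1 hcon))
    · push Not at hex
      exact ⟨C.y s + 1, fun z _ _ => hex z, fun N hN _ => by omega⟩
  choose ℓ h1 h2 using this
  exact ⟨ℓ, h1, h2⟩

/-- Diagonalization with respect to the column. -/
theorem Coordinates.IsStandard.exists_diagonal_x (hC : C.IsStandard W)
    (h3 : C.HasThreeFunctions W) {B : ℕ → Set S} (hB : ∀ N, B N ∈ W) :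
    ∃ H ∈ W, ∀ s ∈ H, ∀ z ∈ C.values H, z < C.x s → s ∈ B z := by
  obtain ⟨ℓ, hℓ, hℓ'⟩ := exists_exit_index (C := C) B
  have hlarge : ∀ N, ∀ᶠ s in (W : Filter S), N < ℓ s := fun N => by
    filter_upwards [hC.eventually_lt_y fun _ => N,
      (eventually_all_finite (Set.finite_Iic N)).2 fun M _ => hB M] with s h1 h2
    exact hℓ' s N h1 h2
  obtain ⟨A, hA, hbdd⟩ : ∃ A ∈ W, ∀ m, BddAbove (C.x '' {s ∈ A | ℓ s ≤ m}) := by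
    obtain ⟨A, hA, ⟨N, hN⟩ | h | h⟩ := h3 ℓ
    · obtain ⟨s, hs, hsN⟩ := W.nonempty_of_mem (inter_mem hA (hlarge N))
      exact absurd (hN s hs) (ne_of_gt hsN)
    · exact ⟨A, hA, bddAbove_image_of_injOn h⟩
    · refine ⟨A, hA, fun m => Set.Finite.bddAbove ?_⟩
      have hfin : (ℓ '' {s ∈ A | ℓ s ≤ m}).Finite :=
        (Set.finite_Iic m).subset (by rintro _ ⟨s, hs, rfl⟩; exact hs.2)
      have : Nonempty S := (W.nonempty_of_mem hA).to_type
      -- `x` factors through `ℓ` on `A`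
      choose! r hr using fun z (hz : z ∈ ℓ '' {s ∈ A | ℓ s ≤ m}) => hz
      refine (hfin.image fun z => C.x (r z)).subset ?_
      rintro _ ⟨s, hs, rfl⟩
      have hs' := hr (ℓ s) ⟨s, hs, rfl⟩
      exact ⟨ℓ s, ⟨s, hs, rfl⟩, (h _ hs'.1.1 s hs.1).1 hs'.2⟩
  obtain ⟨H, hH, hHℓ⟩ := hC.exists_lt_of_bddAbove h3 ℓ C.x mem_values_x hA hbdd
  exact ⟨H, hH, fun s hs z hz hlt =>
    hℓ s z (hHℓ s hs z hz hlt) (hlt.trans (C.x_lt_y s)).le⟩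

/-- Diagonalization with respect to the point: it needs sets that contain almost all points not
only up to constant indices but up to every index that depends on the column. -/
theorem Coordinates.IsStandard.exists_diagonal_y (hC : C.IsStandard W)
    (h3 : C.HasThreeFunctions W) {B : ℕ → Set S}
    (hB : ∀ g : ℕ → ℕ, ∀ᶠ s in (W : Filter S), ∀ M ≤ g (C.x s), s ∈ B M) :
    ∃ H ∈ W, ∀ s ∈ H, ∀ z ∈ C.values H, z < C.y s → s ∈ B z := by
  obtain ⟨ℓ, hℓ, hℓ'⟩ := exists_exit_index (C := C) B
  have hlarge : ∀ g : ℕ → ℕ, ∀ᶠ s in (W : Filter S), g (C.x s) < ℓ s := fun g => by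
    filter_upwards [hC.eventually_lt_y g, hB g] with s h1 h2
    exact hℓ' s _ h1 h2
  obtain ⟨A, hA, hinj⟩ : ∃ A ∈ W, Set.InjOn ℓ A := by
    obtain ⟨A, hA, ⟨N, hN⟩ | h | h⟩ := h3 ℓ
    · obtain ⟨s, hs, hsN⟩ := W.nonempty_of_mem (inter_mem hA (hlarge fun _ => N))
      exact absurd (hN s hs) (ne_of_gt hsN)
    · exact ⟨A, hA, h⟩
    · classical
      let g : ℕ → ℕ := fun a => if h : ∃ s ∈ A, C.x s = a then ℓ h.choose else 0
      obtain ⟨s, hs, hsN⟩ := W.nonempty_of_mem (inter_mem hA (hlarge g))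
      have hex : ∃ t ∈ A, C.x t = C.x s := ⟨s, hs, rfl⟩
      have hg : g (C.x s) = ℓ hex.choose := dif_pos hex
      have heq := (h _ hex.choose_spec.1 s hs).2 hex.choose_spec.2
      exact absurd (hg.trans heq) (ne_of_lt hsN)
  obtain ⟨H, hH, hHℓ⟩ := hC.exists_lt_of_bddAbove h3 ℓ C.y mem_values_y hA
    (bddAbove_image_of_injOn hinj)
  exact ⟨H, hH, fun s hs z hz hlt => hℓ s z (hHℓ s hs z hz hlt) hlt.le⟩

/-- Conservativity for initial segments: the sets `X s` and `Y (x s)` agree not only at any given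
function of the column, but up to it. The least place where they differ, if below such a function,
would itself be a function of the column by the three-functions property. -/
theorem Coordinates.IsConservative.exists_agree (hcons : C.IsConservative W)
    (hC : C.IsStandard W) (h3 : C.HasThreeFunctions W) (X : S → Set ℕ) :
    ∃ Y : ℕ → Set ℕ, ∀ g : ℕ → ℕ, ∀ᶠ s in (W : Filter S), ∀ m ≤ g (C.x s),
      m ∈ X s ↔ m ∈ Y (C.x s) := by
  obtain ⟨Y, hY⟩ := hcons X
  refine ⟨Y, fun g => ?_⟩
  by_contra hcon
  rw [← Ultrafilter.eventually_not] at hcon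
  classical
  let ℓ : S → ℕ := fun s => if h : ∃ m, ¬ (m ∈ X s ↔ m ∈ Y (C.x s)) then Nat.find h else 0
  have hℓ : ∀ᶠ s in (W : Filter S), ℓ s ≤ g (C.x s) ∧ ¬ (ℓ s ∈ X s ↔ ℓ s ∈ Y (C.x s)) := by
    filter_upwards [hcon] with s hs
    push Not at hs
    obtain ⟨m, hm, hne⟩ := hs
    have hex : ∃ m, ¬ (m ∈ X s ↔ m ∈ Y (C.x s)) := ⟨m, by tauto⟩
    have heq : ℓ s = Nat.find hex := dif_pos hex
    rw [heq]
    exact ⟨(Nat.find_le (by tauto)).trans hm, Nat.find_spec hex⟩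
  have hfalse : ∀ (A : Set S) (g' : ℕ → ℕ), A ∈ W → ¬ ∀ s ∈ A, ℓ s = g' (C.x s) := by
    intro A g' hA hg'
    obtain ⟨s, ⟨hsA, hs⟩, hsY⟩ := W.nonempty_of_mem (inter_mem (inter_mem hA hℓ) (hY g'))
    refine hs.2 ?_
    rw [hg' s hsA]
    exact hsY
  obtain ⟨A, hA, ⟨N, hN⟩ | h | h⟩ := h3 ℓ
  · exact hfalse A (fun _ => N) hA hN
  · refine (hC _ (inter_mem hA hℓ)).1 fun a => ?_
    refine Set.Finite.of_finite_image ((Set.finite_Iic (g a)).subset ?_)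
      (h.mono fun s hs => hs.1.1)
    rintro _ ⟨s, ⟨hs, rfl⟩, rfl⟩
    exact hs.2.1
  · refine hfalse A (fun a => if h : ∃ s ∈ A, C.x s = a then ℓ h.choose else 0) hA fun s hs => ?_
    have hex : ∃ t ∈ A, C.x t = C.x s := ⟨s, hs, rfl⟩
    rw [dif_pos hex]
    exact ((h _ hex.choose_spec.1 s hs).2 hex.choose_spec.2).symm

end

/-! ### Homogeneity for shapes -/

section

variable {S : Type*} (C : Coordinates S)

/-- The decreasing list `l` consists of values of the coordinates on `H` as prescribed by the
shape `σ`: an entry `none` of `σ` asks for a column `x s`, and an entry `some j` for a point `y s`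
in the column that stands at position `j` further down the list. -/
def Coordinates.Fits (H : Set S) : List (Option ℕ) → List ℕ → Prop
  | [], [] => True
  | none :: σ, z :: l => Fits H σ l ∧ (∀ w ∈ l, w < z) ∧ ∃ s ∈ H, C.x s = z
  | some j :: σ, z :: l =>
      Fits H σ l ∧ (∀ w ∈ l, w < z) ∧ ∃ s ∈ H, C.y s = z ∧ l[j]? = some (C.x s)
  | _, _ => False

variable {C} {W : Ultrafilter S}

theorem Coordinates.Fits.mono {H H' : Set S} (h : H ⊆ H') {σ : List (Option ℕ)} {l : List ℕ}
    (hl : C.Fits H σ l) : C.Fits H' σ l := by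
  induction σ generalizing l with
  | nil => cases l <;> exact hl
  | cons o σ ih =>
    cases l with
    | nil => cases o <;> exact hl
    | cons z l =>
      cases o with
      | none =>
        obtain ⟨h1, h2, s, hs, h3⟩ := hl
        exact ⟨ih h1, h2, s, h hs, h3⟩
      | some j =>
        obtain ⟨h1, h2, s, hs, h3⟩ := hl
        exact ⟨ih h1, h2, s, h hs, h3⟩

theorem Coordinates.Fits.length_eq {H : Set S} {σ : List (Option ℕ)} {l : List ℕ}
    (hl : C.Fits H σ l) : l.length = σ.length := by
  induction σ generalizing l with
  | nil =>
    cases l with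
    | nil => rfl
    | cons => exact hl.elim
  | cons o σ ih =>
    cases l with
    | nil => cases o <;> exact hl.elim
    | cons z l =>
      cases o <;> exact congrArg Nat.succ (ih hl.1)

theorem Coordinates.Fits.mem_values {H : Set S} {σ : List (Option ℕ)} {l : List ℕ}
    (hl : C.Fits H σ l) : ∀ z ∈ l, z ∈ C.values H := by
  induction σ generalizing l with
  | nil =>
    cases l with
    | nil => simp
    | cons => exact hl.elim
  | cons o σ ih =>
    cases l with
    | nil => simp
    | cons z l =>
      intro w hw
      rcases List.mem_cons.1 hw with rfl | hw
      · cases o with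
        | none => exact Or.inl hl.2.2
        | some j =>
          obtain ⟨-, -, s, hs, h, -⟩ := hl
          exact Or.inr ⟨s, hs, h⟩
      · cases o <;> exact ih hl.1 w hw

/-- A decreasing list is bounded by its head, which is a value on `H`, or is empty. -/
theorem Coordinates.Fits.exists_bound {H : Set S} {σ : List (Option ℕ)} {l : List ℕ}
    (hl : C.Fits H σ l) : ∃ N, (∀ w ∈ l, w ≤ N) ∧ (l = [] ∧ N = 0 ∨ N ∈ l) := by
  cases l with
  | nil => exact ⟨0, by simp⟩
  | cons z l =>
    refine ⟨z, fun w hw => ?_, by simp⟩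
    rcases List.mem_cons.1 hw with rfl | hw
    · exact le_rfl
    · rcases σ with _ | ⟨_ | j, σ⟩
      · exact hl.elim
      · exact (hl.2.1 w hw).le
      · exact (hl.2.1 w hw).le

theorem finite_bounded_lists (r N : ℕ) : {l : List ℕ | l.length = r ∧ ∀ w ∈ l, w ≤ N}.Finite := by
  refine ((List.finite_length_eq (Fin (N + 1)) r).image (List.map Fin.val)).subset ?_
  rintro l ⟨hr, hl⟩
  refine ⟨l.pmap Fin.mk fun w hw => Nat.lt_succ_of_le (hl w hw), by simp [hr], ?_⟩
  simp [List.map_pmap]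

/-- The top entry of the list is removed by passing to a limit along `W`, which is a property of
the remaining entries: for a column, the property that holds for almost all columns; for a point
in an earlier column `a`, the property that holds for almost all points of column `a`, which makes
sense by conservativity. A set on which the limit is attained is found by diagonalization. -/
theorem Coordinates.IsStandard.exists_fits_homogeneous (hC : C.IsStandard W)
    (h3 : C.HasThreeFunctions W) (hcons : C.IsConservative W) (σ : List (Option ℕ))
    (P : List ℕ → Prop) : ∃ H ∈ W, ∃ q : Prop, ∀ l, C.Fits H σ l → (P l ↔ q) := by
  induction σ generalizing P with
  | nil =>
    refine ⟨Set.univ, univ_mem, P [], fun l hl => ?_⟩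
    cases l with
    | nil => rfl
    | cons => exact hl.elim
  | cons o σ ih =>
    cases o with
    | none =>
      obtain ⟨H₀, hH₀, q, hq⟩ := ih fun l => ∀ᶠ s in (W : Filter S), P (C.x s :: l)
      let B : ℕ → Set S := fun N => {s | ∀ l ∈ {l : List ℕ | l.length = σ.length ∧ ∀ w ∈ l, w ≤ N},
        P (C.x s :: l) ↔ ∀ᶠ s in (W : Filter S), P (C.x s :: l)}
      have hB : ∀ N, B N ∈ W := by
        refine fun N => (eventually_all_finite (finite_bounded_lists _ N)).2 fun l _ => ?_
        by_cases hl : ∀ᶠ s in (W : Filter S), P (C.x s :: l)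
        · filter_upwards [hl] with s hs
          exact iff_of_true hs hl
        · filter_upwards [Ultrafilter.eventually_not.2 hl] with s hs
          exact iff_of_false hs hl
      obtain ⟨H, hH, hdiag⟩ := hC.exists_diagonal_x h3 hB
      refine ⟨H ∩ H₀ ∩ B 0, inter_mem (inter_mem hH hH₀) (hB 0), q, fun l hl => ?_⟩
      rcases l with _ | ⟨z, l⟩
      · exact hl.elim
      obtain ⟨hl, hlt, s, hs, rfl⟩ := hl
      rw [← hq l (hl.mono fun p hp => hp.1.2)]
      obtain ⟨N, hN, hNl⟩ := hl.exists_bound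
      have hsB : s ∈ B N := by
        rcases hNl with ⟨-, rfl⟩ | hNl
        · exact hs.2
        · exact hdiag s hs.1.1 N
            ((hl.mono fun p hp => hp.1.1).mem_values N hNl) (hlt N hNl)
      exact hsB l ⟨hl.length_eq, hN⟩
    | some j =>
      obtain ⟨Y, hY⟩ := hcons.exists_agree hC h3
        fun s => {m | ∃ l, Encodable.encode l = m ∧ P (C.y s :: l)}
      have hcode : ∀ s l, (∃ l', Encodable.encode l' = Encodable.encode l ∧ P (C.y s :: l')) ↔
          P (C.y s :: l) := by
        refine fun s l => ⟨?_, fun h => ⟨l, rfl, h⟩⟩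
        rintro ⟨l', hl', h⟩
        rwa [Encodable.encode_injective hl'] at h
      obtain ⟨H₀, hH₀, q, hq⟩ := ih fun l => ∃ a, l[j]? = some a ∧ Encodable.encode l ∈ Y a
      let B : ℕ → Set S := fun N => {s | ∀ l : List ℕ, l.length = σ.length → (∀ w ∈ l, w ≤ N) →
        (P (C.y s :: l) ↔ Encodable.encode l ∈ Y (C.x s))}
      have hB : ∀ g : ℕ → ℕ, ∀ᶠ s in (W : Filter S), ∀ M ≤ g (C.x s), s ∈ B M := by
        intro g
        choose G hG using fun N => ((finite_bounded_lists σ.length N).image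
          (Encodable.encode : List ℕ → ℕ)).bddAbove
        filter_upwards [hY fun a => G (g a)] with s hs M hM l hlr hl
        rw [← hcode]
        exact hs _ (hG _ ⟨l, ⟨hlr, fun w hw => (hl w hw).trans hM⟩, rfl⟩)
      obtain ⟨H, hH, hdiag⟩ := hC.exists_diagonal_y h3 hB
      refine ⟨H ∩ H₀, inter_mem hH hH₀, q, fun l hl => ?_⟩
      rcases l with _ | ⟨z, l⟩
      · exact hl.elim
      obtain ⟨hl, hlt, s, hs, rfl, hj⟩ := hl
      rw [← hq l (hl.mono fun p hp => hp.2)]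
      obtain ⟨N, hN, hNl⟩ := hl.exists_bound
      have hsB : s ∈ B N := by
        rcases hNl with ⟨rfl, -⟩ | hNl
        · simp at hj
        · exact hdiag s hs.1 N ((hl.mono fun p hp => hp.1).mem_values N hNl) (hlt N hNl)
      rw [hsB l hl.length_eq hN]
      constructor
      · exact fun h => ⟨_, hj, h⟩
      · rintro ⟨a, ha, h⟩
        rw [hj] at ha
        cases ha
        exact h

variable {n : ℕ}

/-- The symbols of rank below `k`, one from each class and in decreasing order, with the shape
that describes them. -/
theorem NType.exists_shape (τ : NType n) (k : ℕ) :
    ∃ (ρ : List (Fin n ⊕ Fin n)) (σ : List (Option ℕ)),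
      (∀ (H : Set S) (v : Fin n → S) (hv : StrictMono (C.y ∘ v)), (∀ i, v i ∈ H) →
        C.type v hv = τ → C.Fits H σ (ρ.map (C.sym v))) ∧
      (∀ b ∈ ρ, τ.rank b < k) ∧ ∀ a, τ.rank a < k → ∃ b ∈ ρ, τ.rank b = τ.rank a := by
  induction k with
  | zero => exact ⟨[], [], fun _ _ _ _ _ => trivial, by simp, by simp⟩
  | succ k ih =>
    obtain ⟨ρ, σ, hfit, hlt, hex⟩ := ih
    by_cases hk : ∃ a, τ.rank a = k
    · obtain ⟨a, rfl⟩ := hk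
      have hrest : (∀ b ∈ a :: ρ, τ.rank b < τ.rank a + 1) ∧
          ∀ b, τ.rank b < τ.rank a + 1 → ∃ d ∈ a :: ρ, τ.rank d = τ.rank b := by
        constructor
        · intro b hb
          rcases List.mem_cons.1 hb with rfl | hb
          · exact Nat.lt_succ_self _
          · exact (hlt b hb).trans (Nat.lt_succ_self _)
        · intro b hb
          rcases (Nat.lt_succ_iff.1 hb).eq_or_lt with h | h
          · exact ⟨a, by simp, h.symm⟩
          · obtain ⟨d, hd, hdb⟩ := hex b h
            exact ⟨d, List.mem_cons_of_mem _ hd, hdb⟩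
      have htop : ∀ (v : Fin n → S) (hv : StrictMono (C.y ∘ v)), C.type v hv = τ →
          ∀ w ∈ ρ.map (C.sym v), w < C.sym v a := by
        rintro v hv rfl w hw
        obtain ⟨b, hb, rfl⟩ := List.mem_map.1 hw
        have := hlt b hb
        rw [← not_le, ← NType.le_iff_rank_le] at this
        exact not_le.1 this
      rcases a with i | i
      · exact ⟨Sum.inl i :: ρ, none :: σ, fun H v hv hvH hvτ =>
          ⟨hfit H v hv hvH hvτ, htop v hv hvτ, v i, hvH i, rfl⟩, hrest⟩
      · obtain ⟨b, hb, hbi⟩ := hex _ (τ.rank_inl_lt_inr i)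
        obtain ⟨j, hj⟩ := List.mem_iff_getElem?.1 hb
        refine ⟨Sum.inr i :: ρ, some j :: σ, fun H v hv hvH hvτ =>
          ⟨hfit H v hv hvH hvτ, htop v hv hvτ, v i, hvH i, rfl, ?_⟩, hrest⟩
        have hbv : C.sym v b = C.x (v i) := by
          subst hvτ
          exact le_antisymm (((C.type v hv).le_iff_rank_le (b := Sum.inl i)).2 hbi.le)
            (((C.type v hv).le_iff_rank_le (a := Sum.inl i)).2 hbi.ge)
        rw [List.getElem?_map, hj, Option.map_some, hbv]
    · push Not at hk
      have hk' : ∀ a, τ.rank a < k + 1 → τ.rank a < k := fun a ha =>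
        lt_of_le_of_ne (Nat.lt_succ_iff.1 ha) (hk a)
      exact ⟨ρ, σ, hfit, fun b hb => (hlt b hb).trans (Nat.lt_succ_self _),
        fun a ha => hex a (hk' a ha)⟩

theorem Coordinates.IsStandard.isHomogeneous_of_threeFunctions (hC : C.IsStandard W)
    (h3 : C.HasThreeFunctions W) (hcons : C.IsConservative W) (n : ℕ) :
    C.IsHomogeneous W n := by
  intro R
  choose ρ σ hfit _ hρ using fun τ : NType n => τ.exists_shape (C := C) (n + n + 1)
  choose H hH q hq using fun τ : NType n => hC.exists_fits_homogeneous h3 hcons (σ τ)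
    fun l => ∃ v, StrictMono (C.y ∘ v) ∧ l = (ρ τ).map (C.sym v) ∧ R v
  refine ⟨⋂ τ, H τ, iInter_mem.2 hH, fun v w hv hw hvH hwH hvw hR => ?_⟩
  set τ := C.type v hv with hτ
  have hv' := hq τ _ (hfit τ (H τ) v hv (fun i => Set.mem_iInter.1 (hvH i) τ) rfl)
  have hw' := hq τ _ (hfit τ (H τ) w hw (fun i => Set.mem_iInter.1 (hwH i) τ) hvw.symm)
  obtain ⟨u, hu, huw, hRu⟩ := hw'.2 (hv'.1 ⟨v, hv, rfl, hR⟩)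
  have hwu : w = u := by
    funext i
    obtain ⟨b, hb, hbi⟩ := hρ τ (Sum.inr i) (τ.rank_lt _)
    cases τ.eq_inr_of_rank_eq hbi
    exact C.y_injective (List.map_inj_left.1 huw _ hb)
  rwa [hwu]

/-- The condition on the right does not mention `n`. -/
theorem Coordinates.IsStandard.isWeaklyRamsey_iff (hC : C.IsStandard W) (hn : 2 ≤ n) :
    IsWeaklyRamsey W n (T n) ↔ C.HasThreeFunctions W ∧ C.IsConservative W := by
  constructor
  · intro h
    have h' := hC.isHomogeneous h
    exact ⟨hC.hasThreeFunctions h' hn, hC.isConservative h' hn⟩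
  · rintro ⟨h3, hcons⟩
    exact (hC.isHomogeneous_of_threeFunctions h3 hcons n).isWeaklyRamsey

end

/-! ### Definable sets in ultrapowers of full arithmetic -/

section

/-- By Łoś's theorem every parametrically definable subset of an ultrapower is internal.
Conversely, an internal set `[F]` is defined by the standard relation `m ∈ F s` between `m` and
the code of `s`, with the class of the coding function as a parameter. -/
theorem definable₁_iff_internal {S : Type*} [Countable S] (U : Ultrafilter S) (X : Set (UPow U)) :
    (Set.univ : Set (UPow U)).Definable₁ fullArith X ↔
      ∃ F : S → Set ℕ, ∀ g : S → ℕ, cls U g ∈ X ↔ ∀ᶠ s in (U : Filter S), g s ∈ F s := by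
  have hlos : ∀ (φ : fullArith.Formula ((Set.univ : Set (UPow U)) ⊕ Fin 1))
      (r : ↥(Set.univ : Set (UPow U)) → S → ℕ) (g : S → ℕ),
      (φ.Realize fun i => cls U (Sum.elim r (fun _ => g) i)) ↔
        ∀ᶠ s in (U : Filter S), φ.Realize (Sum.elim (fun p => r p s) fun _ => g s) := by
    intro φ r g
    refine (Ultraproduct.realize_formula_cast (u := U) φ (Sum.elim r fun _ => g)).trans ?_
    refine eventually_congr (Eventually.of_forall fun s => ?_)
    have : (fun i => Sum.elim r (fun _ => g) i s) =
        Sum.elim (fun p => r p s) fun _ : Fin 1 => g s := by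
      funext i
      cases i <;> rfl
    rw [this]
  have hout : ∀ p : UPow U, cls U p.out = p := fun p => Quotient.out_eq p
  have hval : ∀ (r : ↥(Set.univ : Set (UPow U)) → S → ℕ) (g : S → ℕ), (∀ p, cls U (r p) = p.1) →
      (fun i => cls U (Sum.elim r (fun _ => g) i)) =
        Sum.elim (fun p : (Set.univ : Set (UPow U)) => p.1) fun _ : Fin 1 => cls U g := by
    intro r g hr
    funext i
    rcases i with p | i
    · exact hr p
    · rfl
  constructor
  · intro h
    obtain ⟨φ, hφ⟩ := Set.definable_iff_exists_formula_sum.1 h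
    refine ⟨fun s => {m | φ.Realize (Sum.elim (fun p => p.1.out s) fun _ => m)}, fun g => ?_⟩
    have h1 := Set.ext_iff.1 hφ fun _ => cls U g
    refine h1.trans ?_
    rw [Set.mem_ofPred_eq, ← hval (fun p => p.1.out) g fun p => hout p.1]
    exact hlos φ _ g
  · rintro ⟨F, hF⟩
    obtain ⟨e, he⟩ := exists_injective_nat S
    let R : fullArith.Relations 2 := fun v => ∃ s, e s = v 1 ∧ v 0 ∈ F s
    let φ : fullArith.Formula ((Set.univ : Set (UPow U)) ⊕ Fin 1) :=
      R.formula₂ (Term.var (Sum.inr 0)) (Term.var (Sum.inl ⟨cls U e, trivial⟩))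
    refine Set.definable_iff_exists_formula_sum.2 ⟨φ, ?_⟩
    ext x
    obtain ⟨g, hg⟩ : ∃ g, cls U g = x 0 := ⟨_, hout (x 0)⟩
    have hx : x = fun _ => cls U g := by
      funext i
      rw [Subsingleton.elim i 0, hg]
    subst hx
    classical
    let r : ↥(Set.univ : Set (UPow U)) → S → ℕ := fun p => if p.1 = cls U e then e else p.1.out
    have hr : ∀ p, cls U (r p) = p.1 := by
      intro p
      by_cases hp : p.1 = cls U e
      · simp only [r, if_pos hp, hp]
      · simp only [r, if_neg hp, hout]
    have hre : r ⟨cls U e, trivial⟩ = e := if_pos rfl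
    rw [Set.mem_ofPred_eq, Set.mem_ofPred_eq, ← hval r g hr]
    refine (hF g).trans (Iff.trans ?_ (hlos φ r g).symm)
    refine eventually_congr (Eventually.of_forall fun s => ?_)
    rw [Formula.realize_rel₂]
    change _ ↔ ∃ t, e t = r ⟨cls U e, trivial⟩ s ∧ g s ∈ F t
    rw [hre]
    constructor
    · exact fun h => ⟨s, rfl, h⟩
    · rintro ⟨t, ht, h⟩
      rwa [he ht] at h

theorem isConservativeMap_iff {S : Type*} [Countable S] (U : Ultrafilter S) (f : S → ℕ) :
    IsConservativeMap U f ↔ ∀ X : S → Set ℕ, ∃ Y : ℕ → Set ℕ, ∀ g : ℕ → ℕ,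
      ∀ᶠ s in (U : Filter S), g (f s) ∈ X s ↔ g (f s) ∈ Y (f s) := by
  have hsplit : ∀ p q : S → Prop, (∀ᶠ s in (U : Filter S), p s ↔ q s) ↔
      ((∀ᶠ s in (U : Filter S), p s) ↔ ∀ᶠ s in (U : Filter S), q s) := by
    intro p q
    refine ⟨fun h => eventually_congr h, fun h => ?_⟩
    by_cases hp : ∀ᶠ s in (U : Filter S), p s
    · filter_upwards [hp, h.1 hp] with s h1 h2
      exact iff_of_true h1 h2
    · filter_upwards [Ultrafilter.eventually_not.2 hp,
        Ultrafilter.eventually_not.2 fun hq => hp (h.2 hq)] with s h1 h2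
      exact iff_of_false h1 h2
  constructor
  · intro h X
    let Z : Set (UPow U) := {z | ∃ g, cls U g = z ∧ ∀ᶠ s in (U : Filter S), g s ∈ X s}
    have hZ : ∀ g, cls U g ∈ Z ↔ ∀ᶠ s in (U : Filter S), g s ∈ X s := by
      refine fun g => ⟨?_, fun hg => ⟨g, rfl, hg⟩⟩
      rintro ⟨g', hg', hX⟩
      have heq : ∀ᶠ s in (U : Filter S), g' s = g s := Quotient.exact hg'
      filter_upwards [hX, heq] with s h1 h2
      rwa [← h2]
    obtain ⟨Y, hY⟩ := (definable₁_iff_internal _ _).1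
      (h Z ((definable₁_iff_internal U Z).2 ⟨X, hZ⟩))
    exact ⟨Y, fun g => (hsplit _ _).2 ((hZ (g ∘ f)).symm.trans (hY g))⟩
  · intro h Z hZ
    obtain ⟨X, hX⟩ := (definable₁_iff_internal U Z).1 hZ
    obtain ⟨Y, hY⟩ := h X
    exact (definable₁_iff_internal _ _).2
      ⟨Y, fun g => (hX (g ∘ f)).trans ((hsplit _ _).1 (hY g))⟩

end

/-! ### Coordinates for non-P-points -/

section

variable {S : Type*} {W : Ultrafilter S}

theorem Coordinates.isStandard_ofInjective {Y : Type*} {f : S → Y} {h e : S → ℕ}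
    (he : Function.Injective e) (hf : ∀ A ∈ W, ¬ FiniteToOneOn f A ∧ ¬ ConstantOn f A)
    (hfh : ∀ s t, h s = h t ↔ f s = f t) : (Coordinates.ofInjective h e he).IsStandard W := by
  have hx : ∀ s t, (Coordinates.ofInjective h e he).x s = (Coordinates.ofInjective h e he).x t ↔
      f s = f t := by
    intro s t
    rw [← hfh]
    change 2 * h s = 2 * h t ↔ _
    omega
  refine fun A hA => ⟨fun hfin => (hf A hA).1 fun y => ?_, fun hconst => (hf A hA).2 ?_⟩
  · by_cases hex : ∃ s, f s = y
    · obtain ⟨s, rfl⟩ := hex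
      exact (hfin ((Coordinates.ofInjective h e he).x s)).subset
        fun t ht => ⟨ht.1, (hx t s).2 ht.2⟩
    · exact Set.Finite.subset Set.finite_empty fun t ht => hex ⟨t, ht.2⟩
  · obtain ⟨a, ha⟩ := hconst
    obtain ⟨s, hs⟩ := W.nonempty_of_mem hA
    exact ⟨f s, fun t ht => (hx t s).1 ((ha t ht).trans (ha s hs).symm)⟩

theorem exists_nat_eq_iff [Countable S] {Y : Type*} (f : S → Y) :
    ∃ h : S → ℕ, ∀ s t, h s = h t ↔ f s = f t := by
  have := (Set.countable_range f).to_subtype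
  obtain ⟨c, hc⟩ := exists_injective_nat (Set.range f)
  exact ⟨c ∘ Set.rangeFactorization f, fun s t => hc.eq_iff.trans Subtype.ext_iff⟩

theorem exists_isStandard [Countable S] (h : ¬ IsPPoint W) :
    ∃ C : Coordinates S, C.IsStandard W := by
  unfold IsPPoint at h
  push Not at h
  obtain ⟨Y, f, hf⟩ := h
  obtain ⟨e, he⟩ := exists_injective_nat S
  obtain ⟨c, hc⟩ := exists_nat_eq_iff f
  exact ⟨_, Coordinates.isStandard_ofInjective he hf hc⟩

/-- The coordinates on `ω²` in which the columns are the fibres of the first projection. -/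
def prodCoordinates : Coordinates (ℕ × ℕ) :=
  Coordinates.ofInjective Prod.fst (Encodable.encode : ℕ × ℕ → ℕ) Encodable.encode_injective

theorem prodCoordinates_x (s : ℕ × ℕ) : prodCoordinates.x s = 2 * s.1 := rfl

theorem hasThreeFunctions_prod_iff (W : Ultrafilter (ℕ × ℕ)) :
    prodCoordinates.HasThreeFunctions W ↔ ThreeFunctions W := by
  have hx : ∀ s t, prodCoordinates.x s = prodCoordinates.x t ↔ s.1 = t.1 := by
    intro s t
    rw [prodCoordinates_x, prodCoordinates_x]
    omega
  constructor
  · intro h Y f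
    obtain ⟨c, hcf⟩ := exists_nat_eq_iff f
    obtain ⟨A, hA, ⟨N, hN⟩ | hinj | hcol⟩ := h c
    · obtain ⟨s, hs⟩ := W.nonempty_of_mem hA
      exact ⟨A, hA, Or.inl ⟨f s, fun t ht => (hcf t s).1 ((hN t ht).trans (hN s hs).symm)⟩⟩
    · exact ⟨A, hA, Or.inr (Or.inl fun s hs t ht hst => hinj hs ht ((hcf s t).2 hst))⟩
    · refine ⟨A, hA, Or.inr (Or.inr ?_)⟩
      have hcol' : ∀ s ∈ A, ∀ t ∈ A, f s = f t ↔ s.1 = t.1 := fun s hs t ht => by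
        rw [← hcf, ← hx]
        exact hcol s hs t ht
      obtain ⟨s₀, hs₀⟩ := W.nonempty_of_mem hA
      classical
      let g : ℕ → Y := fun a => if h : ∃ s ∈ A, s.1 = a then f h.choose else f s₀
      have hg : ∀ s ∈ A, f s = g s.1 := by
        intro s hs
        have hex : ∃ t ∈ A, t.1 = s.1 := ⟨s, hs, rfl⟩
        have : g s.1 = f hex.choose := dif_pos hex
        rw [this]
        exact ((hcol' _ hex.choose_spec.1 s hs).2 hex.choose_spec.2).symm
      refine ⟨g, ?_, hg⟩
      rintro _ ⟨s, hs, rfl⟩ _ ⟨t, ht, rfl⟩ hst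
      rw [← hg s hs, ← hg t ht] at hst
      exact (hcol' s hs t ht).1 hst
  · intro h f
    obtain ⟨A, hA, hconst | hinj | ⟨g, hg, hfg⟩⟩ := h ℕ f
    · exact ⟨A, hA, Or.inl hconst⟩
    · exact ⟨A, hA, Or.inr (Or.inl hinj)⟩
    · refine ⟨A, hA, Or.inr (Or.inr fun s hs t ht => ?_)⟩
      rw [hfg s hs, hfg t ht, hx, hg.eq_iff ⟨s, hs, rfl⟩ ⟨t, ht, rfl⟩]

theorem isConservative_prod_iff (W : Ultrafilter (ℕ × ℕ)) :
    prodCoordinates.IsConservative W ↔ IsConservativeMap W (Prod.fst : ℕ × ℕ → ℕ) := by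
  rw [isConservativeMap_iff]
  refine forall_congr' fun X => ⟨?_, ?_⟩
  · rintro ⟨Y, hY⟩
    refine ⟨fun a => Y (2 * a), fun g => ?_⟩
    filter_upwards [hY fun a => g (a / 2)] with s hs
    rw [prodCoordinates_x, Nat.mul_div_cancel_left _ two_pos] at hs
    exact hs
  · rintro ⟨Y, hY⟩
    refine ⟨fun a => Y (a / 2), fun g => ?_⟩
    filter_upwards [hY fun a => g (2 * a)] with s hs
    rw [prodCoordinates_x, Nat.mul_div_cancel_left _ two_pos]
    exact hs

end

end WeakRamsey

theorem mainTheorem3 :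
    (∀ (S : Type*) [Countable S] [Infinite S] (W : Ultrafilter S),
      WeakRamsey.Nonprincipal W → ¬ WeakRamsey.IsPPoint W →
        ∀ m n : ℕ, 2 ≤ m → 2 ≤ n →
          (WeakRamsey.IsWeaklyRamsey W m (WeakRamsey.T m) ↔
            WeakRamsey.IsWeaklyRamsey W n (WeakRamsey.T n))) ∧
    (∀ W : Ultrafilter (ℕ × ℕ), WeakRamsey.IsStandardPosition W →
      ∀ n : ℕ, 2 ≤ n →
        (WeakRamsey.IsWeaklyRamsey W n (WeakRamsey.T n) ↔
          WeakRamsey.ThreeFunctions W ∧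
            WeakRamsey.IsConservativeMap W (Prod.fst : ℕ × ℕ → ℕ))) := by
  constructor
  · intro S _ _ W _ hW m n hm hn
    obtain ⟨C, hC⟩ := WeakRamsey.exists_isStandard hW
    exact (hC.isWeaklyRamsey_iff hm).trans (hC.isWeaklyRamsey_iff hn).symm
  · intro W hW n hn
    have hC : WeakRamsey.prodCoordinates.IsStandard W :=
      WeakRamsey.Coordinates.isStandard_ofInjective _ hW fun _ _ => Iff.rfl
    rw [hC.isWeaklyRamsey_iff hn, WeakRamsey.hasThreeFunctions_prod_iff,
      WeakRamsey.isConservative_prod_iff]
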